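/- Let $\mathcal W_2(\mathbb R)$ be the set of Borel probability measures on $\mathbb R$ with finite second moment, with the quadratic Wasserstein distance $$W_2(\mu,\nu)=\Big(\inf_{\pi\in\Pi(\mu,\nu)}\int_{\mathbb R\times\mathbb R}|x-y|^2\,d\pi(x,y)\Big)^{1/2},$$ where $\Pi(\mu,\nu)$ is the set of probability measures on $\mathbb R\times\mathbb R$ with marginals $\mu$ and $\nu$. For $0\le H\le 1$ and $\mu_0\in\mathcal W_2(\mathbb R)$ put $$K^{H,\mu_0}(\mu,\nu)=\tfrac12\left(W_2^{2H}(\mu_0,\mu)+W_2^{2H}(\mu_0,\nu)-W_2^{2H}(\mu,\nu)\right),\qquad \mu,\nu\in\mathcal W_2(\mathbb R),$$ with the convention $0^0=1$ (so $W_2^{0}\equiv 1$). A symmetric function $K:E\times E\to\mathbb R$ on a set $E$ is a positive definite kernel if $\sum_{i,j=1}^n\lambda_i\lambda_jK(x_i,x_j)\ge 0$ for all $n$, $x_1,\dots,x_n\in E$ and $\lambda_1,\dots,\lambda_n\in\mathbb R$; it is nondegenerate if moreover this inequality is strict whenever the $x_i$ are pairwise distinct and not all $\lambda_i$ are zero.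 Then for every $0\le H\le 1$ and every $\mu_0\in\mathcal W_2(\mathbb R)$: 1. $K^{H,\mu_0}$ is a covariance function on $\mathcal W_2(\mathbb R)$, that is, it is a positive definite kernel, and there is a Gaussian process $(X(\mu))_{\mu\in\mathcal W_2(\mathbb R)}$ on some probability space with $\mathbb E X(\mu)=0$ and $\operatorname{Cov}(X(\mu),X(\nu))=K^{H,\mu_0}(\mu,\nu)$ for all $\mu,\nu$ (the $H$-fractional Brownian motion indexed by $\mathcal W_2(\mathbb R)$ with origin in $\mu_0$). 2. The restriction of $K^{H,\mu_0}$ to $\mathcal W_2(\mathbb R)\setminus\{\mu_0\}$ is nondegenerate if and only if $0<H<1$. -/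

import Mathlib

open MeasureTheory ProbabilityTheory
open scoped ENNReal

noncomputable section

/-- The set `𝒲₂(ℝ)` of Borel probability measures on `ℝ` with finite moment of order two. -/
abbrev WassersteinSpace : Type :=
  {μ : Measure ℝ // IsProbabilityMeasure μ ∧ ∫⁻ x, ‖x‖ₑ ^ 2 ∂μ < ∞}

/-- `Π(μ, ν)`: the probability measures on `ℝ × ℝ` with first marginal `μ` and second
marginal `ν`. -/
def couplings (μ ν : WassersteinSpace) : Set (Measure (ℝ × ℝ)) :=
  {π | IsProbabilityMeasure π ∧ π.map Prod.fst = μ.1 ∧ π.map Prod.snd = ν.1}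

/-- The quadratic transportation cost `𝒯₂(μ, ν) = inf_{π ∈ Π(μ, ν)} ∫ |x - y|² dπ(x, y)`,
with values in `[0, ∞]`. -/
def transportCost (μ ν : WassersteinSpace) : ℝ≥0∞ :=
  ⨅ π ∈ couplings μ ν, ∫⁻ p, ‖p.1 - p.2‖ₑ ^ 2 ∂π

/-- The quadratic Wasserstein distance `W₂(μ, ν) = 𝒯₂(μ, ν)^{1/2}`. The cost is finite, since both
measures have finite second moments. -/
def wassersteinDist (μ ν : WassersteinSpace) : ℝ :=
  Real.sqrt (transportCost μ ν).toReal

/-- The fractional Brownian kernel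
`K^{H,μ₀}(μ, ν) = ½ (W₂^{2H}(μ₀, μ) + W₂^{2H}(μ₀, ν) - W₂^{2H}(μ, ν))`.
The real power has `0 ^ 0 = 1`, so that `W₂^{2H}` is the constant `1` for `H = 0`. -/
def fbmKernel (H : ℝ) (μ₀ μ ν : WassersteinSpace) : ℝ :=
  (1 / 2 : ℝ) * (wassersteinDist μ₀ μ ^ (2 * H) + wassersteinDist μ₀ ν ^ (2 * H)
    - wassersteinDist μ ν ^ (2 * H))

/-- A positive definite kernel on a set `E`: a symmetric function `K : E × E → ℝ` with
`∑ i j, cᵢ cⱼ K(xᵢ, xⱼ) ≥ 0` for all points `xᵢ` and all real `cᵢ`. -/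
def IsPosDefKernel {E : Type*} (K : E → E → ℝ) : Prop :=
  (∀ x y, K x y = K y x) ∧
    ∀ (n : ℕ) (x : Fin n → E) (c : Fin n → ℝ), 0 ≤ ∑ i, ∑ j, c i * c j * K (x i) (x j)

/-- A positive definite kernel is nondegenerate if the inequality is strict as soon as the points
are pairwise distinct and not all the coefficients vanish. -/
def IsNondegenerateKernel {E : Type*} (K : E → E → ℝ) : Prop :=
  IsPosDefKernel K ∧
    ∀ (n : ℕ) (x : Fin n → E) (c : Fin n → ℝ), Function.Injective x → c ≠ 0 →
      0 < ∑ i, ∑ j, c i * c j * K (x i) (x j)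

/-- The `H`-fractional Brownian motion with index space `𝒲₂(ℝ)` and origin in `μ₀`: a centred
Gaussian process with covariance `K^{H,μ₀}`. -/
structure IsFractionalBrownianMotion {Ω : Type*} [MeasurableSpace Ω] (P : Measure Ω)
    (H : ℝ) (μ₀ : WassersteinSpace) (X : WassersteinSpace → Ω → ℝ) : Prop where
  measurable : ∀ μ, Measurable (X μ)
  gaussian : IsGaussianProcess X P
  centred : ∀ μ, ∫ ω, X μ ω ∂P = 0
  covariance : ∀ μ ν, cov[X μ, X ν; P] = fbmKernel H μ₀ μ ν

end

/-! On the line the quantile coupling is optimal for the quadratic cost, so sending a measure to its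
quantile function embeds the Wasserstein space isometrically into the Hilbert space L²(0,1)
(`transportCost_eq`, `wassersteinDist_eq`). Both kernel claims thereby reduce to the kernel built
from ‖x - y‖^(2H) on an inner product space.

For 0 < H < 1, r^(2H) is a positive multiple of ∫₀^∞ (1 - exp(-t r²)) t^(-H-1) dt, so the quadratic
form is a mixture over t of forms coming from Gaussian kernels, each nonnegative by Schur's product
theorem. As t → ∞ the Gaussian form tends to (∑ cᵢ)² + ∑ cᵢ², when the points are distinct and
differ from the origin; hence the integrand is positive for large t and the form is strictly
positive. At H = 1 the form is a squared norm and at H = 0 the kernel is constant; in both cases two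
translates of μ₀ give a degenerate combination.

The process is obtained by realising the kernel as a Gram matrix in a Hilbert space and applying an
isonormal Gaussian process to those vectors. -/

/-! ### Quantile functions. -/

/-- The uniform probability measure on the unit interval. -/
noncomputable def unifMeasure : Measure ℝ := volume.restrict (Set.Ioo 0 1)

instance : IsProbabilityMeasure unifMeasure :=
  ⟨by simp [unifMeasure]⟩

/-- The quantile function of a measure on the line. -/
noncomputable def quantile (μ : Measure ℝ) (u : ℝ) : ℝ := sInf {x | u ≤ cdf μ x}

/-- The Galois connection between quantile and cdf; every later fact about quantiles goes through
it. The bounds on `u` make the defining set bounded below and nonempty, so that `sInf` is not a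
default value. -/
lemma quantile_le_iff (μ : Measure ℝ) {u : ℝ} (h0 : 0 < u) (h1 : u < 1) (x : ℝ) :
    quantile μ u ≤ x ↔ u ≤ cdf μ x := by
  have hbdd : BddBelow {x | u ≤ cdf μ x} := by
    obtain ⟨a, ha⟩ := ((tendsto_cdf_atBot μ).eventually (gt_mem_nhds h0)).exists
    refine ⟨a, fun y hy => ?_⟩
    by_contra! hlt
    exact absurd (hy.trans (monotone_cdf μ hlt.le)) (not_le.2 ha)
  have hne : {x | u ≤ cdf μ x}.Nonempty := by
    obtain ⟨a, ha⟩ := ((tendsto_cdf_atTop μ).eventually (lt_mem_nhds h1)).exists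
    exact ⟨a, ha.le⟩
  refine ⟨fun h => ?_, fun h => csInf_le hbdd h⟩
  -- The bound holds at every `y > x`; right continuity carries it to `x`.
  have hright : Filter.Tendsto (cdf μ) (nhdsWithin x (Set.Ioi x)) (nhds (cdf μ x)) :=
    ((cdf μ).right_continuous x).mono_left (nhdsWithin_mono _ Set.Ioi_subset_Ici_self)
  refine ge_of_tendsto hright ?_
  filter_upwards [self_mem_nhdsWithin] with y hy
  obtain ⟨z, hz, hzy⟩ := exists_lt_of_csInf_lt hne (lt_of_le_of_lt h hy)
  exact le_trans hz (monotone_cdf μ hzy.le)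

lemma aemeasurable_quantile (μ : Measure ℝ) : AEMeasurable (quantile μ) unifMeasure := by
  refine aemeasurable_restrict_of_monotoneOn measurableSet_Ioo fun u hu v hv huv => ?_
  rw [quantile_le_iff μ hu.1 hu.2]
  exact huv.trans ((quantile_le_iff μ hv.1 hv.2 _).1 le_rfl)

lemma ae_unifMeasure : ∀ᵐ u ∂unifMeasure, 0 < u ∧ u < 1 :=
  ae_restrict_mem measurableSet_Ioo

lemma unifMeasure_Iic {a : ℝ} (h1 : a ≤ 1) :
    unifMeasure (Set.Iic a) = ENNReal.ofReal a := by
  rw [unifMeasure, Measure.restrict_apply measurableSet_Iic]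
  refine le_antisymm ?_ ?_
  · calc _ ≤ volume (Set.Ioc 0 a) := measure_mono fun x hx => ⟨hx.2.1, hx.1⟩
      _ = _ := by simp
  · have h : Set.Ioo 0 a ⊆ Set.Iic a ∩ Set.Ioo 0 1 :=
      fun x hx => ⟨hx.2.le, hx.1, hx.2.trans_le h1⟩
    simpa using measure_mono (μ := volume) h

lemma unifMeasure_Ioc {a b : ℝ} (h0 : 0 ≤ a) (h1 : b ≤ 1) :
    unifMeasure (Set.Ioc a b) = ENNReal.ofReal (b - a) := by
  rw [unifMeasure, Measure.restrict_apply measurableSet_Ioc]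
  refine le_antisymm ?_ ?_
  · calc _ ≤ volume (Set.Ioc a b) := measure_mono fun x hx => hx.1
      _ = _ := by simp
  · have h : Set.Ioo a b ⊆ Set.Ioc a b ∩ Set.Ioo 0 1 := fun x hx =>
      ⟨⟨hx.1, hx.2.le⟩, h0.trans_lt hx.1, hx.2.trans_le h1⟩
    simpa using measure_mono (μ := volume) h

lemma map_quantile (μ : Measure ℝ) [IsProbabilityMeasure μ] :
    unifMeasure.map (quantile μ) = μ := by
  have := Measure.isProbabilityMeasure_map (aemeasurable_quantile μ)
  refine Measure.ext_of_Iic _ _ fun x => ?_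
  rw [Measure.map_apply_of_aemeasurable (aemeasurable_quantile μ) measurableSet_Iic,
    ← ofReal_cdf, ← unifMeasure_Iic (cdf_le_one μ x)]
  refine measure_congr ?_
  filter_upwards [ae_unifMeasure] with u hu
  exact propext (quantile_le_iff μ hu.1 hu.2 x)

/-! ### Optimality of the quantile coupling. -/

/-- The squared distance is the area of the square with side `[x, y)` or `[y, x)`, the other square
being empty. This turns the cost of a coupling into an integral of masses of quadrants. -/
lemma enorm_sub_sq_eq_lintegral (x y : ℝ) :
    ‖x - y‖ₑ ^ 2 = ∫⁻ st : ℝ × ℝ,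
      ({p : ℝ × ℝ | p.1 ≤ min st.1 st.2 ∧ max st.1 st.2 < p.2}.indicator 1 (x, y) +
       {p : ℝ × ℝ | p.2 ≤ min st.1 st.2 ∧ max st.1 st.2 < p.1}.indicator 1 (x, y)) := by
  have key : ∀ st : ℝ × ℝ,
      ({p : ℝ × ℝ | p.1 ≤ min st.1 st.2 ∧ max st.1 st.2 < p.2}.indicator 1 (x, y) +
       {p : ℝ × ℝ | p.2 ≤ min st.1 st.2 ∧ max st.1 st.2 < p.1}.indicator 1 (x, y) : ℝ≥0∞) =
      (Set.Ico x y ×ˢ Set.Ico x y).indicator 1 st + (Set.Ico y x ×ˢ Set.Ico y x).indicator 1 st := by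
    intro st
    congr 1 <;>
    · simp only [Set.indicator_apply, Set.mem_ofPred_eq, Set.mem_prod, Set.mem_Ico, le_min_iff,
        max_lt_iff]
      congr 1
      exact propext ⟨by tauto, by tauto⟩
  simp_rw [key]
  have hm : ∀ a b : ℝ, MeasurableSet (Set.Ico a b ×ˢ Set.Ico a b) := fun a b =>
    measurableSet_Ico.prod measurableSet_Ico
  rw [lintegral_add_left (measurable_one.indicator (hm x y)), lintegral_indicator_one (hm _ _),
    lintegral_indicator_one (hm _ _), Measure.volume_eq_prod, Measure.prod_prod, Measure.prod_prod]
  simp only [Real.volume_Ico]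
  rcases le_total x y with h | h
  · rw [ENNReal.ofReal_of_nonpos (sub_nonpos.2 h), ← ofReal_norm, Real.norm_eq_abs, abs_sub_comm,
      abs_of_nonneg (sub_nonneg.2 h)]
    ring
  · rw [ENNReal.ofReal_of_nonpos (sub_nonpos.2 h), ← ofReal_norm, Real.norm_eq_abs,
      abs_of_nonneg (sub_nonneg.2 h)]
    ring

lemma measurableSet_le_and_lt {α : Type*} [MeasurableSpace α] {f g h k : α → ℝ}
    (hf : Measurable f) (hg : Measurable g) (hh : Measurable h) (hk : Measurable k) :
    MeasurableSet {x | f x ≤ g x ∧ h x < k x} :=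
  (measurableSet_le hf hg).inter (measurableSet_lt hh hk)

lemma lintegral_enorm_sub_sq (π : Measure (ℝ × ℝ)) [IsProbabilityMeasure π] :
    ∫⁻ p, ‖p.1 - p.2‖ₑ ^ 2 ∂π = ∫⁻ st : ℝ × ℝ,
      (π {p | p.1 ≤ min st.1 st.2 ∧ max st.1 st.2 < p.2} +
       π {p | p.2 ≤ min st.1 st.2 ∧ max st.1 st.2 < p.1}) := by
  have h1 : MeasurableSet {q : (ℝ × ℝ) × (ℝ × ℝ) |
      q.1.1 ≤ min q.2.1 q.2.2 ∧ max q.2.1 q.2.2 < q.1.2} :=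
    measurableSet_le_and_lt (by fun_prop) (by fun_prop) (by fun_prop) (by fun_prop)
  have h2 : MeasurableSet {q : (ℝ × ℝ) × (ℝ × ℝ) |
      q.1.2 ≤ min q.2.1 q.2.2 ∧ max q.2.1 q.2.2 < q.1.1} :=
    measurableSet_le_and_lt (by fun_prop) (by fun_prop) (by fun_prop) (by fun_prop)
  have s1 : ∀ st : ℝ × ℝ,
      MeasurableSet {p : ℝ × ℝ | p.1 ≤ min st.1 st.2 ∧ max st.1 st.2 < p.2} := fun st =>
    h1.preimage (f := fun p => (p, st)) (by fun_prop)
  have s2 : ∀ st : ℝ × ℝ,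
      MeasurableSet {p : ℝ × ℝ | p.2 ≤ min st.1 st.2 ∧ max st.1 st.2 < p.1} := fun st =>
    h2.preimage (f := fun p => (p, st)) (by fun_prop)
  simp_rw [enorm_sub_sq_eq_lintegral]
  rw [lintegral_lintegral_swap]
  · refine lintegral_congr fun st => ?_
    rw [lintegral_add_left (measurable_one.indicator (s1 st)), lintegral_indicator_one (s1 st),
      lintegral_indicator_one (s2 st)]
  · exact ((measurable_one.indicator h1).add (measurable_one.indicator h2)).aemeasurable

/-- The coupling of two measures by their quantile functions. -/
noncomputable def quantileCoupling (μ ν : Measure ℝ) : Measure (ℝ × ℝ) :=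
  unifMeasure.map fun u => (quantile μ u, quantile ν u)

lemma aemeasurable_quantile_prodMk (μ ν : Measure ℝ) :
    AEMeasurable (fun u => (quantile μ u, quantile ν u)) unifMeasure :=
  (aemeasurable_quantile μ).prodMk (aemeasurable_quantile ν)

instance (μ ν : Measure ℝ) : IsProbabilityMeasure (quantileCoupling μ ν) :=
  Measure.isProbabilityMeasure_map (aemeasurable_quantile_prodMk μ ν)

lemma quantileCoupling_mem (μ ν : WassersteinSpace) :
    quantileCoupling μ.1 ν.1 ∈ couplings μ ν := by
  have := μ.2.1
  have := ν.2.1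
  refine ⟨inferInstance, ?_, ?_⟩
  · rw [quantileCoupling, AEMeasurable.map_map_of_aemeasurable measurable_fst.aemeasurable
      (aemeasurable_quantile_prodMk _ _)]
    exact map_quantile μ.1
  · rw [quantileCoupling, AEMeasurable.map_map_of_aemeasurable measurable_snd.aemeasurable
      (aemeasurable_quantile_prodMk _ _)]
    exact map_quantile ν.1

/-- A lower bound on quadrant masses that depends only on the marginals; the subtraction is
truncated at zero. -/
lemma sub_le_coupling {π : Measure (ℝ × ℝ)} [IsProbabilityMeasure π] (f g : ℝ × ℝ → ℝ)
    (hf : Measurable f) (hg : Measurable g) (m M : ℝ) :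
    π.map f (Set.Iic m) - π.map g (Set.Iic M) ≤ π {p | f p ≤ m ∧ M < g p} := by
  rw [Measure.map_apply hf measurableSet_Iic, Measure.map_apply hg measurableSet_Iic]
  refine le_measure_sdiff.trans (measure_mono fun p hp => ⟨hp.1, not_le.1 hp.2⟩)

/-- Up to a null set the event is the interval from `cdf ν M` to `cdf μ m`, so the quantile coupling
attains the bound of `sub_le_coupling`, for all quadrants simultaneously. -/
lemma unifMeasure_quantile (μ ν : Measure ℝ) [IsProbabilityMeasure μ] [IsProbabilityMeasure ν]
    (m M : ℝ) :
    unifMeasure {u | quantile μ u ≤ m ∧ M < quantile ν u} = μ (Set.Iic m) - ν (Set.Iic M) := by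
  rw [← ofReal_cdf, ← ofReal_cdf, ← ENNReal.ofReal_sub _ (cdf_nonneg _ _),
    ← unifMeasure_Ioc (cdf_nonneg _ _) (cdf_le_one _ _)]
  refine measure_congr ?_
  filter_upwards [ae_unifMeasure] with u hu
  refine propext ?_
  change (_ ≤ _ ∧ _ < _) ↔ (_ < _ ∧ _ ≤ _)
  rw [quantile_le_iff μ hu.1 hu.2, ← not_le, quantile_le_iff ν hu.1 hu.2, not_le, and_comm]

lemma transportCost_eq (μ ν : WassersteinSpace) :
    transportCost μ ν = ∫⁻ u, ‖quantile μ.1 u - quantile ν.1 u‖ₑ ^ 2 ∂unifMeasure := by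
  have := μ.2.1
  have := ν.2.1
  have hq : ∫⁻ p, ‖p.1 - p.2‖ₑ ^ 2 ∂(quantileCoupling μ.1 ν.1) =
      ∫⁻ u, ‖quantile μ.1 u - quantile ν.1 u‖ₑ ^ 2 ∂unifMeasure :=
    lintegral_map' (by fun_prop) (aemeasurable_quantile_prodMk _ _)
  rw [← hq]
  refine le_antisymm (iInf₂_le _ (quantileCoupling_mem μ ν)) (le_iInf₂ fun π hπ => ?_)
  obtain ⟨hp, h1, h2⟩ := hπ
  rw [lintegral_enorm_sub_sq, lintegral_enorm_sub_sq]
  refine lintegral_mono fun st => ?_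
  refine add_le_add ?_ ?_
  · rw [quantileCoupling, Measure.map_apply_of_aemeasurable (aemeasurable_quantile_prodMk _ _)
      (measurableSet_le_and_lt measurable_fst measurable_const measurable_const measurable_snd)]
    refine (unifMeasure_quantile μ.1 ν.1 _ _).trans_le ?_
    rw [← h1, ← h2]
    exact sub_le_coupling _ _ measurable_fst measurable_snd _ _
  · rw [quantileCoupling, Measure.map_apply_of_aemeasurable (aemeasurable_quantile_prodMk _ _)
      (measurableSet_le_and_lt measurable_snd measurable_const measurable_const measurable_fst)]
    refine (unifMeasure_quantile ν.1 μ.1 _ _).trans_le ?_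
    rw [← h1, ← h2]
    exact sub_le_coupling _ _ measurable_snd measurable_fst _ _

/-! ### Isometric embedding into L²(0,1). -/

lemma memLp_quantile (μ : WassersteinSpace) : MemLp (quantile μ.1) 2 unifMeasure := by
  have := μ.2.1
  refine ⟨(aemeasurable_quantile _).aestronglyMeasurable, ?_⟩
  rw [eLpNorm_lt_top_iff_lintegral_rpow_enorm_lt_top (by simp) (by simp)]
  have h := μ.2.2
  rw [← map_quantile μ.1, lintegral_map' (by fun_prop) (aemeasurable_quantile _)] at h
  simpa using h

/-- The quantile function of a measure with finite second moment, as an element of `L²(0, 1)`. -/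
noncomputable def quantileLp (μ : WassersteinSpace) : Lp ℝ 2 unifMeasure :=
  (memLp_quantile μ).toLp _

lemma wassersteinDist_eq (μ ν : WassersteinSpace) :
    wassersteinDist μ ν = ‖quantileLp μ - quantileLp ν‖ := by
  rw [wassersteinDist, transportCost_eq, quantileLp, quantileLp, ← MemLp.toLp_sub, Lp.norm_toLp,
    eLpNorm_eq_lintegral_rpow_enorm_toReal (by simp) (by simp), ← ENNReal.toReal_rpow,
    Real.sqrt_eq_rpow]
  simp

lemma quantileLp_injective : Function.Injective quantileLp := by
  intro μ ν h
  have := μ.2.1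
  have := ν.2.1
  have h' := (MemLp.toLp_eq_toLp_iff _ _).1 h
  refine Subtype.ext ?_
  rw [← map_quantile μ.1, ← map_quantile ν.1]
  exact Measure.map_congr h'

/-! ### Translates of a measure. -/

/-- The translate of a measure by a real number. -/
noncomputable def translated (μ : WassersteinSpace) (a : ℝ) : WassersteinSpace :=
  ⟨μ.1.map (· + a), by
    have := μ.2.1
    refine ⟨Measure.isProbabilityMeasure_map (by fun_prop), ?_⟩
    rw [lintegral_map (by fun_prop) (by fun_prop)]
    have hid : MemLp (id : ℝ → ℝ) 2 μ.1 := by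
      refine ⟨aestronglyMeasurable_id, ?_⟩
      rw [eLpNorm_lt_top_iff_lintegral_rpow_enorm_lt_top (by simp) (by simp)]
      simpa using μ.2.2
    have h := (hid.add (memLp_const a)).2
    rw [eLpNorm_lt_top_iff_lintegral_rpow_enorm_lt_top (by simp) (by simp)] at h
    simpa using h⟩

lemma quantile_translated (μ : WassersteinSpace) (a : ℝ) {u : ℝ} (h0 : 0 < u) (h1 : u < 1) :
    quantile (translated μ a).1 u = quantile μ.1 u + a := by
  have := μ.2.1
  have := (translated μ a).2.1
  refine eq_of_forall_ge_iff fun x => ?_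
  rw [quantile_le_iff _ h0 h1, ← le_sub_iff_add_le, quantile_le_iff _ h0 h1, cdf_eq_real,
    cdf_eq_real, measureReal_def, measureReal_def]
  have : (translated μ a).1 (Set.Iic x) = μ.1 (Set.Iic (x - a)) := by
    rw [translated, Measure.map_apply (by fun_prop) measurableSet_Iic]
    congr 1
    ext y
    simp [le_sub_iff_add_le]
  rw [this]

/-- Quantile functions of translates differ by a constant. The translates thus form an isometric
copy of ℝ, which supplies the degenerate examples for H = 0 and H = 1. -/
lemma wassersteinDist_translated (μ : WassersteinSpace) (a b : ℝ) :
    wassersteinDist (translated μ a) (translated μ b) = |a - b| := by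
  rw [wassersteinDist, transportCost_eq]
  have : ∫⁻ u, ‖quantile (translated μ a).1 u - quantile (translated μ b).1 u‖ₑ ^ 2 ∂unifMeasure =
      ∫⁻ _, ‖a - b‖ₑ ^ 2 ∂unifMeasure := by
    refine lintegral_congr_ae ?_
    filter_upwards [ae_unifMeasure] with u hu
    rw [quantile_translated μ a hu.1 hu.2, quantile_translated μ b hu.1 hu.2,
      add_sub_add_left_eq_sub]
  rw [this]
  simp [Real.sqrt_sq_eq_abs]

lemma translated_zero (μ : WassersteinSpace) : translated μ 0 = μ :=
  Subtype.ext (by simp [translated])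

/-! ### Integral representation of r^(2H). -/

-- Near zero, 1 - exp(-t) ≤ t leaves t^(-H), integrable since H < 1; at infinity t^(-H-1) dominates,
-- integrable since H > 0.
open Filter Topology Set in
lemma integrableOn_one_sub_exp_mul_rpow {H : ℝ} (h0 : 0 < H) (h1 : H < 1) :
    IntegrableOn (fun t : ℝ => (1 - Real.exp (-t)) * t ^ (-H - 1)) (Ioi 0) := by
  have hmeas : ∀ s : Set ℝ, AEStronglyMeasurable
      (fun t : ℝ => (1 - Real.exp (-t)) * t ^ (-H - 1)) (volume.restrict s) := fun s => by
    have : Measurable fun t : ℝ => (1 - Real.exp (-t)) * t ^ (-H - 1) := by fun_prop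
    exact this.aestronglyMeasurable
  have hnn : ∀ t : ℝ, 0 < t → 0 ≤ 1 - Real.exp (-t) := fun t ht => by
    have := Real.exp_le_one_iff.2 (neg_nonpos.2 ht.le)
    linarith
  rw [← Ioc_union_Ioi_eq_Ioi zero_le_one]
  refine IntegrableOn.union ?_ ?_
  · have hi : IntegrableOn (fun t : ℝ => t ^ (-H)) (Ioc 0 1) := by
      have := intervalIntegral.intervalIntegrable_rpow' (a := 0) (b := 1) (r := -H) (by linarith)
      rwa [intervalIntegrable_iff_integrableOn_Ioc_of_le zero_le_one] at this
    refine hi.mono' (hmeas _) ?_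
    filter_upwards [ae_restrict_mem measurableSet_Ioc] with t ht
    rw [Real.norm_of_nonneg (mul_nonneg (hnn t ht.1) (Real.rpow_nonneg ht.1.le _))]
    have h2 : t ^ (-H) = t * t ^ (-H - 1) := by
      rw [Real.rpow_sub_one ht.1.ne']
      field_simp [ht.1.ne']
    rw [h2]
    refine mul_le_mul_of_nonneg_right ?_ (Real.rpow_nonneg ht.1.le _)
    have := Real.add_one_le_exp (-t)
    linarith
  · have hi : IntegrableOn (fun t : ℝ => t ^ (-H - 1)) (Ioi 1) :=
      integrableOn_Ioi_rpow_of_lt (by linarith) one_pos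
    refine hi.mono' (hmeas _) ?_
    filter_upwards [ae_restrict_mem measurableSet_Ioi] with t ht
    have ht0 : 0 < t := one_pos.trans ht
    rw [Real.norm_of_nonneg (mul_nonneg (hnn t ht0) (Real.rpow_nonneg ht0.le _))]
    refine mul_le_of_le_one_left (Real.rpow_nonneg ht0.le _) ?_
    have := Real.exp_pos (-t)
    linarith

/-- The constant in the integral representation of `r ↦ r ^ (2 * H)`. -/
noncomputable def fbmConst (H : ℝ) : ℝ :=
  ∫ t in Set.Ioi (0 : ℝ), (1 - Real.exp (-t)) * t ^ (-H - 1)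

open Set in
lemma setIntegral_Ioi_pos {f : ℝ → ℝ} (hf : IntegrableOn f (Ioi 0)) (hnn : ∀ t, 0 < t → 0 ≤ f t)
    {T : ℝ} (hT : 0 ≤ T) (hpos : ∀ t, T < t → 0 < f t) : 0 < ∫ t in Ioi (0 : ℝ), f t := by
  rw [setIntegral_pos_iff_support_of_nonneg_ae _ hf]
  · have : Ioi T ⊆ Function.support f ∩ Ioi 0 := fun t ht => ⟨(hpos t ht).ne', hT.trans_lt ht⟩
    refine lt_of_lt_of_le ?_ (measure_mono this)
    simp
  · filter_upwards [ae_restrict_mem measurableSet_Ioi] with t ht using hnn t ht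

lemma fbmConst_pos {H : ℝ} (h0 : 0 < H) (h1 : H < 1) : 0 < fbmConst H := by
  have hpos : ∀ t : ℝ, 0 < t → 0 < (1 - Real.exp (-t)) * t ^ (-H - 1) := fun t ht => by
    have := Real.exp_lt_one_iff.2 (neg_lt_zero.2 ht)
    exact mul_pos (by linarith) (Real.rpow_pos_of_pos ht _)
  exact setIntegral_Ioi_pos (integrableOn_one_sub_exp_mul_rpow h0 h1)
    (fun t ht => (hpos t ht).le) le_rfl hpos

open Set in
/-- The integral representation of `r ^ (2 * H)` by Gaussian functions. -/
lemma rpow_two_mul_eq_integral {H : ℝ} (h0 : 0 < H) (h1 : H < 1) {r : ℝ} (hr : 0 ≤ r) :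
    IntegrableOn (fun t : ℝ => (1 - Real.exp (-(t * r ^ 2))) * t ^ (-H - 1)) (Ioi 0) ∧
    ∫ t in Ioi (0 : ℝ), (1 - Real.exp (-(t * r ^ 2))) * t ^ (-H - 1) =
      fbmConst H * r ^ (2 * H) := by
  rcases hr.eq_or_lt with rfl | hr
  · simp [Real.zero_rpow (by linarith : 2 * H ≠ 0)]
  have hr2 : 0 < r ^ 2 := by positivity
  let f : ℝ → ℝ := fun t => (1 - Real.exp (-t)) * t ^ (-H - 1)
  have hf : EqOn (fun t : ℝ => (1 - Real.exp (-(t * r ^ 2))) * t ^ (-H - 1))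
      -- Rescaling t by r²: the Jacobian r⁻² reduces the factor (r²)^(H+1) to (r²)^H.
      (fun t => (r ^ 2) ^ (H + 1) * f (r ^ 2 * t)) (Ioi 0) := fun t ht => by
    have ht : 0 < t := ht
    simp only [f]
    rw [Real.mul_rpow hr2.le ht.le, mul_comm t, mul_left_comm, ← mul_assoc ((r ^ 2) ^ (H + 1)),
      ← Real.rpow_add hr2]
    simp
  have hInt : IntegrableOn (fun t => (r ^ 2) ^ (H + 1) * f (r ^ 2 * t)) (Ioi 0) := by
    refine Integrable.const_mul ?_ _
    refine (integrableOn_Ioi_comp_mul_left_iff f 0 hr2).2 ?_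
    simpa using integrableOn_one_sub_exp_mul_rpow h0 h1
  refine ⟨hInt.congr_fun hf.symm measurableSet_Ioi, ?_⟩
  rw [setIntegral_congr_fun measurableSet_Ioi hf, integral_const_mul,
    integral_comp_mul_left_Ioi f 0 hr2, mul_zero, smul_eq_mul, ← mul_assoc, mul_comm]
  congr 1
  rw [← Real.rpow_neg_one (r ^ 2), ← Real.rpow_add hr2, ← Real.rpow_natCast, ← Real.rpow_mul hr.le]
  congr 1
  push_cast
  ring

lemma Matrix.PosSemidef.sum_sum_nonneg {n : ℕ} {M : Matrix (Fin n) (Fin n) ℝ} (hM : M.PosSemidef)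
    (c : Fin n → ℝ) : 0 ≤ ∑ i, ∑ j, c i * c j * M i j := by
  have := hM.dotProduct_mulVec_nonneg c
  simp only [dotProduct, Matrix.mulVec, Finset.mul_sum, star_trivial] at this
  refine this.trans_eq (Finset.sum_congr rfl fun i _ => Finset.sum_congr rfl fun j _ => ?_)
  ring

open Set in
lemma integral_gaussian_increment {E : Type*} [NormedAddCommGroup E] {H : ℝ} (h0 : 0 < H)
    (h1 : H < 1) (x₀ : E) {n : ℕ} (x : Fin n → E) (c : Fin n → ℝ) :
    IntegrableOn (fun t : ℝ => (∑ i, ∑ j, c i * c j * ((1 - Real.exp (-(t * ‖x₀ - x i‖ ^ 2))) +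
      (1 - Real.exp (-(t * ‖x₀ - x j‖ ^ 2))) - (1 - Real.exp (-(t * ‖x i - x j‖ ^ 2))))) *
        t ^ (-H - 1)) (Ioi 0) ∧
    ∫ t in Ioi (0 : ℝ), (∑ i, ∑ j, c i * c j * ((1 - Real.exp (-(t * ‖x₀ - x i‖ ^ 2))) +
      (1 - Real.exp (-(t * ‖x₀ - x j‖ ^ 2))) - (1 - Real.exp (-(t * ‖x i - x j‖ ^ 2))))) *
        t ^ (-H - 1) =
    fbmConst H * ∑ i, ∑ j, c i * c j *
      (‖x₀ - x i‖ ^ (2 * H) + ‖x₀ - x j‖ ^ (2 * H) - ‖x i - x j‖ ^ (2 * H)) := by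
  have hr := fun y : E => rpow_two_mul_eq_integral h0 h1 (norm_nonneg y)
  have heq : ∀ t : ℝ, (∑ i, ∑ j, c i * c j * ((1 - Real.exp (-(t * ‖x₀ - x i‖ ^ 2))) +
      (1 - Real.exp (-(t * ‖x₀ - x j‖ ^ 2))) - (1 - Real.exp (-(t * ‖x i - x j‖ ^ 2))))) *
        t ^ (-H - 1) = ∑ i, ∑ j, c i * c j *
      ((1 - Real.exp (-(t * ‖x₀ - x i‖ ^ 2))) * t ^ (-H - 1) +
      (1 - Real.exp (-(t * ‖x₀ - x j‖ ^ 2))) * t ^ (-H - 1) -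
      (1 - Real.exp (-(t * ‖x i - x j‖ ^ 2))) * t ^ (-H - 1)) := fun t => by
    simp_rw [Finset.sum_mul]
    exact Finset.sum_congr rfl fun i _ => Finset.sum_congr rfl fun j _ => by ring
  simp_rw [heq]
  have hij : ∀ i j, Integrable (fun t : ℝ => c i * c j *
      ((1 - Real.exp (-(t * ‖x₀ - x i‖ ^ 2))) * t ^ (-H - 1) +
      (1 - Real.exp (-(t * ‖x₀ - x j‖ ^ 2))) * t ^ (-H - 1) -
      (1 - Real.exp (-(t * ‖x i - x j‖ ^ 2))) * t ^ (-H - 1))) (volume.restrict (Ioi 0)) :=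
    fun i j => (((hr _).1.add (hr _).1).sub (hr _).1).const_mul _
  refine ⟨integrable_finsetSum _ fun i _ => integrable_finsetSum _ fun j _ => hij i j, ?_⟩
  rw [integral_finsetSum _ fun i _ => integrable_finsetSum _ fun j _ => hij i j, Finset.mul_sum]
  refine Finset.sum_congr rfl fun i _ => ?_
  rw [integral_finsetSum _ fun j _ => hij i j, Finset.mul_sum]
  refine Finset.sum_congr rfl fun j _ => ?_
  have hadd : Integrable (fun t : ℝ => (1 - Real.exp (-(t * ‖x₀ - x i‖ ^ 2))) * t ^ (-H - 1) +
      (1 - Real.exp (-(t * ‖x₀ - x j‖ ^ 2))) * t ^ (-H - 1)) (volume.restrict (Ioi 0)) :=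
    (hr _).1.add (hr _).1
  rw [integral_const_mul, integral_sub hadd (hr _).1,
    integral_add (hr _).1 (hr _).1, (hr _).2, (hr _).2, (hr _).2]
  ring

/-! ### Positivity of the forms in an inner product space. -/

section Hilbert

variable {E : Type*} [NormedAddCommGroup E] [InnerProductSpace ℝ E]

/-- Schur's product theorem applied repeatedly to the Gram matrix, starting from the all-ones
matrix; these are the terms of the exponential series. -/
lemma posSemidef_inner_pow {n : ℕ} (x : Fin n → E) (k : ℕ) :
    (Matrix.of fun i j => inner ℝ (x i) (x j) ^ k : Matrix (Fin n) (Fin n) ℝ).PosSemidef := by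
  induction k with
  | zero =>
    convert! Matrix.posSemidef_gram ℝ (fun _ : Fin n => (1 : ℝ)) using 1
    ext i j
    simp [Matrix.gram]
  | succ k ih =>
    convert! ih.hadamard (Matrix.posSemidef_gram ℝ x) using 1

lemma sum_sum_exp_inner_nonneg {n : ℕ} (x : Fin n → E) (c : Fin n → ℝ) {s : ℝ} (hs : 0 ≤ s) :
    0 ≤ ∑ i, ∑ j, c i * c j * Real.exp (s * inner ℝ (x i) (x j)) := by
  have h : HasSum (fun k : ℕ => ∑ i, ∑ j,
      c i * c j * ((s * inner ℝ (x i) (x j)) ^ k / k.factorial))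
      (∑ i, ∑ j, c i * c j * Real.exp (s * inner ℝ (x i) (x j))) := by
    refine hasSum_sum fun i _ => hasSum_sum fun j _ => HasSum.mul_left _ ?_
    rw [Real.exp_eq_exp_ℝ]
    exact NormedSpace.expSeries_div_hasSum_exp _
  refine h.nonneg fun k => ?_
  have := mul_nonneg (div_nonneg (pow_nonneg hs k) (Nat.cast_nonneg (α := ℝ) k.factorial))
    ((posSemidef_inner_pow x k).sum_sum_nonneg c)
  refine this.trans_eq ?_
  simp only [Finset.mul_sum, Matrix.of_apply]
  refine Finset.sum_congr rfl fun i _ => Finset.sum_congr rfl fun j _ => ?_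
  rw [mul_pow]
  ring

/-- The Gaussian kernel on an inner product space is positive definite. -/
lemma sum_sum_gaussian_nonneg {n : ℕ} (x : Fin n → E) (c : Fin n → ℝ) {t : ℝ} (ht : 0 ≤ t) :
    0 ≤ ∑ i, ∑ j, c i * c j * Real.exp (-(t * ‖x i - x j‖ ^ 2)) := by
  -- Expanding ‖xᵢ - xⱼ‖², the diagonal factors are absorbed into the weights and exp(2t⟨xᵢ, xⱼ⟩)
  -- remains.
  refine (sum_sum_exp_inner_nonneg x (fun i => c i * Real.exp (-(t * ‖x i‖ ^ 2)))
    (s := 2 * t) (by linarith)).trans_eq ?_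
  refine Finset.sum_congr rfl fun i _ => Finset.sum_congr rfl fun j _ => ?_
  have : Real.exp (-(t * ‖x i - x j‖ ^ 2)) = Real.exp (-(t * ‖x i‖ ^ 2)) *
      Real.exp (-(t * ‖x j‖ ^ 2)) * Real.exp (2 * t * inner ℝ (x i) (x j)) := by
    rw [← Real.exp_add, ← Real.exp_add, norm_sub_sq_real]
    congr 1
    ring
  rw [this]
  ring

/-- The increments of the Gaussian kernel from a base point form a positive definite kernel. -/
lemma sum_sum_gaussian_increment_nonneg (x₀ : E) {n : ℕ} (x : Fin n → E) (c : Fin n → ℝ)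
    {t : ℝ} (ht : 0 ≤ t) :
    0 ≤ ∑ i, ∑ j, c i * c j * ((1 - Real.exp (-(t * ‖x₀ - x i‖ ^ 2))) +
      (1 - Real.exp (-(t * ‖x₀ - x j‖ ^ 2))) - (1 - Real.exp (-(t * ‖x i - x j‖ ^ 2)))) := by
  -- Adjoining `x₀` with weight -∑ cᵢ makes the total weight zero; the Gaussian form on the enlarged
  -- family is then exactly the increment form.
  have h := sum_sum_gaussian_nonneg (Fin.cons x₀ x : Fin (n + 1) → E)
    (Fin.cons (-∑ i, c i) c : Fin (n + 1) → ℝ) ht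
  refine h.trans_eq ?_
  have hcol : ∑ i, ∑ j, c i * c j * Real.exp (-(t * ‖x₀ - x i‖ ^ 2)) =
      (∑ j, c j) * ∑ i, c i * Real.exp (-(t * ‖x₀ - x i‖ ^ 2)) := by
    rw [mul_comm, Finset.sum_mul_sum]
    exact Finset.sum_congr rfl fun i _ => Finset.sum_congr rfl fun j _ => by ring
  have hrow : ∑ i, ∑ j, c i * c j * Real.exp (-(t * ‖x₀ - x j‖ ^ 2)) =
      (∑ j, c j) * ∑ i, c i * Real.exp (-(t * ‖x₀ - x i‖ ^ 2)) := by
    rw [Finset.sum_mul_sum]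
    exact Finset.sum_congr rfl fun i _ => Finset.sum_congr rfl fun j _ => by ring
  have hone : ∑ i, ∑ j, c i * c j = (∑ j, c j) * ∑ i, c i := by
    rw [Finset.sum_mul_sum]
  have hexp : ∀ i j, c i * c j * ((1 - Real.exp (-(t * ‖x₀ - x i‖ ^ 2))) +
      (1 - Real.exp (-(t * ‖x₀ - x j‖ ^ 2))) - (1 - Real.exp (-(t * ‖x i - x j‖ ^ 2)))) =
      c i * c j - c i * c j * Real.exp (-(t * ‖x₀ - x i‖ ^ 2)) -
      c i * c j * Real.exp (-(t * ‖x₀ - x j‖ ^ 2)) +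
      c i * c j * Real.exp (-(t * ‖x i - x j‖ ^ 2)) := fun i j => by ring
  simp_rw [hexp, Finset.sum_add_distrib, Finset.sum_sub_distrib, hcol, hrow, hone]
  simp only [Fin.sum_univ_succ, Fin.cons_zero, Fin.cons_succ, sub_self, norm_zero,
    Finset.sum_add_distrib, norm_sub_rev _ x₀]
  simp only [mul_assoc, ← Finset.mul_sum, mul_left_comm _ (-∑ i, c i)]
  simp
  ring

/-- For `0 < H < 1`, the fractional Brownian form of an inner product space is nonnegative. -/
lemma sum_sum_norm_rpow_nonneg {H : ℝ} (h0 : 0 < H) (h1 : H < 1) (x₀ : E) {n : ℕ}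
    (x : Fin n → E) (c : Fin n → ℝ) :
    0 ≤ ∑ i, ∑ j, c i * c j *
      (‖x₀ - x i‖ ^ (2 * H) + ‖x₀ - x j‖ ^ (2 * H) - ‖x i - x j‖ ^ (2 * H)) := by
  refine nonneg_of_mul_nonneg_right ?_ (fbmConst_pos h0 h1)
  rw [← (integral_gaussian_increment h0 h1 x₀ x c).2]
  refine setIntegral_nonneg measurableSet_Ioi fun t ht => ?_
  exact mul_nonneg (sum_sum_gaussian_increment_nonneg x₀ x c (le_of_lt ht))
    (Real.rpow_nonneg (le_of_lt ht) _)

open Filter Topology in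
/-- For `0 < H < 1`, the fractional Brownian form of an inner product space is positive on distinct
points away from the origin. -/
lemma sum_sum_norm_rpow_pos {H : ℝ} (h0 : 0 < H) (h1 : H < 1) (x₀ : E) {n : ℕ}
    (x : Fin n → E) (c : Fin n → ℝ) (hx : Function.Injective x) (hx₀ : ∀ i, x i ≠ x₀)
    (hc : c ≠ 0) :
    0 < ∑ i, ∑ j, c i * c j *
      (‖x₀ - x i‖ ^ (2 * H) + ‖x₀ - x j‖ ^ (2 * H) - ‖x i - x j‖ ^ (2 * H)) := by
  refine pos_of_mul_pos_right ?_ (fbmConst_pos h0 h1).le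
  rw [← (integral_gaussian_increment h0 h1 x₀ x c).2]
  have hexp : ∀ y : E, y ≠ 0 →
      Tendsto (fun t : ℝ => Real.exp (-(t * ‖y‖ ^ 2))) atTop (𝓝 0) := fun y hy => by
    have hy2 : 0 < ‖y‖ ^ 2 := by positivity
    exact Real.tendsto_exp_neg_atTop_nhds_zero.comp (tendsto_id.atTop_mul_const hy2)
  have hlim : Tendsto (fun t : ℝ => ∑ i, ∑ j, c i * c j *
      ((1 - Real.exp (-(t * ‖x₀ - x i‖ ^ 2))) + (1 - Real.exp (-(t * ‖x₀ - x j‖ ^ 2))) -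
        (1 - Real.exp (-(t * ‖x i - x j‖ ^ 2))))) atTop
      (𝓝 (∑ i, ∑ j, c i * c j * ((1 - 0) + (1 - 0) - (1 - if i = j then 1 else 0)))) := by
    refine tendsto_finsetSum _ fun i _ => tendsto_finsetSum _ fun j _ => Tendsto.const_mul _ ?_
    have hi := hexp (x₀ - x i) (sub_ne_zero.2 (hx₀ i).symm)
    have hj := hexp (x₀ - x j) (sub_ne_zero.2 (hx₀ j).symm)
    refine Tendsto.sub ((hi.const_sub 1).add (hj.const_sub 1)) (Tendsto.const_sub 1 ?_)
    split_ifs with hij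
    · simp [hij]
    · exact hexp _ (sub_ne_zero.2 (hx.ne hij))
  -- The limiting kernel is 1 + δᵢⱼ.
  have hpos : 0 < ∑ i, ∑ j, c i * c j * ((1 - 0) + (1 - 0) - (1 - if i = j then (1 : ℝ) else 0)) := by
    have : ∑ i, ∑ j, c i * c j * ((1 - 0) + (1 - 0) - (1 - if i = j then (1 : ℝ) else 0)) =
        (∑ i, c i) ^ 2 + ∑ i, c i ^ 2 := by
      have h : ∀ i j, c i * c j * ((1 - 0) + (1 - 0) - (1 - if i = j then (1 : ℝ) else 0)) =
          c i * c j + if i = j then c i * c j else 0 := fun i j => by split_ifs <;> ring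
      simp_rw [h, Finset.sum_add_distrib]
      rw [sq (∑ i, c i), Finset.sum_mul_sum]
      simp [sq]
    rw [this]
    obtain ⟨i, hi⟩ := Function.ne_iff.1 hc
    have : 0 < ∑ i, c i ^ 2 :=
      Finset.sum_pos' (fun i _ => sq_nonneg _) ⟨i, Finset.mem_univ i, sq_pos_iff.2 hi⟩
    positivity
  obtain ⟨T, hT⟩ := eventually_atTop.1 (hlim.eventually (lt_mem_nhds hpos))
  refine setIntegral_Ioi_pos (integral_gaussian_increment h0 h1 x₀ x c).1 (fun t ht => ?_)
    (le_max_left 0 T) (fun t ht => ?_)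
  · exact mul_nonneg (sum_sum_gaussian_increment_nonneg x₀ x c ht.le) (Real.rpow_nonneg ht.le _)
  · exact mul_pos (hT t ((le_max_right 0 T).trans ht.le))
      (Real.rpow_pos_of_pos ((le_max_left 0 T).trans_lt ht) _)

/-- The Brownian form with `H = 1` is a squared norm. -/
lemma sum_sum_norm_sq_eq (x₀ : E) {n : ℕ} (x : Fin n → E) (c : Fin n → ℝ) :
    ∑ i, ∑ j, c i * c j * (‖x₀ - x i‖ ^ 2 + ‖x₀ - x j‖ ^ 2 - ‖x i - x j‖ ^ 2) =
      2 * ‖∑ i, c i • (x i - x₀)‖ ^ 2 := by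
  rw [← real_inner_self_eq_norm_sq, sum_inner, Finset.mul_sum]
  refine Finset.sum_congr rfl fun i _ => ?_
  rw [inner_sum, Finset.mul_sum]
  refine Finset.sum_congr rfl fun j _ => ?_
  rw [real_inner_smul_left, real_inner_smul_right,
    real_inner_eq_norm_mul_self_add_norm_mul_self_sub_norm_sub_mul_self_div_two,
    sub_sub_sub_cancel_right, norm_sub_rev x₀, norm_sub_rev x₀]
  ring

end Hilbert

/-! ### Gaussian processes with prescribed covariance. -/

lemma IsPosDefKernel.sum_finset_nonneg {T : Type*} {K : T → T → ℝ} (hK : IsPosDefKernel K)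
    (s : Finset T) (c : T → ℝ) : 0 ≤ ∑ i ∈ s, ∑ j ∈ s, c i * c j * K i j := by
  have h := hK.2 s.card (fun i => (s.equivFin.symm i : T)) (fun i => c (s.equivFin.symm i : T))
  refine h.trans_eq ?_
  have key : ∀ f : T → ℝ, ∑ i : Fin s.card, f (s.equivFin.symm i : T) = ∑ i ∈ s, f i := fun f => by
    rw [Equiv.sum_comp s.equivFin.symm (fun i : s => f i), Finset.sum_coe_sort]
  rw [← key fun i => ∑ j ∈ s, c i * c j * K i j]
  exact Finset.sum_congr rfl fun i _ =>
    key fun j => c (s.equivFin.symm i) * c j * K (s.equivFin.symm i) j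

/-- A positive definite kernel is the Gram matrix of a family of vectors in a Hilbert space. -/
lemma IsPosDefKernel.exists_inner_eq {T : Type} {K : T → T → ℝ} (hK : IsPosDefKernel K) :
    ∃ (V : Type) (_ : NormedAddCommGroup V) (_ : InnerProductSpace ℝ V) (_ : CompleteSpace V)
      (φ : T → V), ∀ s t, inner ℝ (φ s) (φ t) = K s t := by
  -- The scalar kernel is viewed as operator-valued on ℝ; the vectors are the kernel functions of
  -- its reproducing kernel Hilbert space.
  let M : Matrix T T (ℝ →L[ℝ] ℝ) := .of fun s t => K s t • ContinuousLinearMap.id ℝ ℝ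
  have hM : M.PosSemidef := by
    have hiff := (RKHS.posSemidef_tfae (K := M)).out 0 2
    refine hiff.2 ⟨?_, fun v => ?_⟩
    · ext s t
      have hid : ContinuousLinearMap.adjoint (ContinuousLinearMap.id ℝ ℝ) = .id ℝ ℝ :=
        ContinuousLinearMap.adjoint_id
      simp [M, Matrix.conjTranspose_apply, hK.1 t s, ContinuousLinearMap.star_eq_adjoint, hid]
    · refine (hK.sum_finset_nonneg v.support v).trans_eq ?_
      simp only [Finsupp.sum, M, Matrix.of_apply]
      refine Finset.sum_congr rfl fun i _ => Finset.sum_congr rfl fun j _ => ?_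
      simp [hK.1 j i]
      ring
  have : Fact M.PosSemidef := ⟨hM⟩
  refine ⟨RKHS.OfKernel M, inferInstance, inferInstance, inferInstance,
    fun t => RKHS.kerFun (RKHS.OfKernel M) t 1, fun s t => ?_⟩
  rw [RKHS.kerFun_inner, RKHS.kerFun_apply, RKHS.OfKernel.kernel_ofKernel]
  simp [M]

section L2

variable {Ω : Type*} [MeasurableSpace Ω] {P : Measure Ω} [IsProbabilityMeasure P]

lemma integral_norm_le_Lp_norm (f : Lp ℝ 2 P) : ∫ ω, ‖f ω‖ ∂P ≤ ‖f‖ := by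
  rw [integral_norm_eq_lintegral_enorm (Lp.aestronglyMeasurable f), ← eLpNorm_one_eq_lintegral_enorm,
    Lp.norm_def]
  exact ENNReal.toReal_mono (Lp.memLp f).2.ne
    (eLpNorm_le_eLpNorm_of_exponent_le (by norm_num) (Lp.aestronglyMeasurable f))

lemma continuous_Lp_two_integral : Continuous fun f : Lp ℝ 2 P => ∫ ω, f ω ∂P := by
  refine LipschitzWith.continuous (K := 1) (LipschitzWith.of_dist_le_mul fun f g => ?_)
  have hInt : ∀ f : Lp ℝ 2 P, Integrable f P := fun f => (Lp.memLp f).integrable (by norm_num)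
  rw [NNReal.coe_one, one_mul, dist_eq_norm, dist_eq_norm, ← integral_sub (hInt f) (hInt g)]
  refine le_trans (le_of_eq ?_) ((norm_integral_le_integral_norm _).trans
    (integral_norm_le_Lp_norm (f - g)))
  congr 1
  refine integral_congr_ae ?_
  filter_upwards [Lp.coeFn_sub f g] with ω hω
  exact hω.symm

/-- Lipschitz with constant |t|, because |exp(ia) - exp(ib)| ≤ |a - b| and the L¹ norm is at most
the L² norm. -/
lemma continuous_Lp_two_charFun (t : ℝ) :
    Continuous fun f : Lp ℝ 2 P => charFun (P.map f) t := by
  have hm : ∀ f : Lp ℝ 2 P, Measurable f := fun f => (Lp.stronglyMeasurable f).measurable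
  have hchar : ∀ f : Lp ℝ 2 P,
      charFun (P.map f) t = ∫ ω, Complex.exp (t * f ω * Complex.I) ∂P := fun f => by
    rw [charFun_apply_real, integral_map (hm f).aemeasurable (by fun_prop)]
  simp_rw [hchar]
  have hnorm : ∀ x : ℝ, ‖Complex.exp (t * x * Complex.I)‖ = 1 := fun x => by
    rw [← Complex.ofReal_mul, Complex.norm_exp_ofReal_mul_I]
  have hInt : ∀ f : Lp ℝ 2 P, Integrable (fun ω => Complex.exp (t * f ω * Complex.I)) P := fun f => by
    refine (integrable_const (1 : ℝ)).mono' ?_ (ae_of_all _ fun ω => (hnorm _).le)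
    have := hm f
    exact Measurable.aestronglyMeasurable (by fun_prop)
  refine LipschitzWith.continuous (K := ⟨|t|, abs_nonneg t⟩)
    (LipschitzWith.of_dist_le_mul fun f g => ?_)
  rw [dist_eq_norm, dist_eq_norm, ← integral_sub (hInt f) (hInt g)]
  have hfg : Integrable (fun ω => |t| * ‖(f - g) ω‖) P :=
    ((Lp.memLp (f - g)).integrable (by norm_num)).norm.const_mul _
  calc _ ≤ ∫ ω, |t| * ‖(f - g) ω‖ ∂P := by
        refine norm_integral_le_of_norm_le hfg ?_
        filter_upwards [Lp.coeFn_sub f g] with ω hω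
        have h1 : Complex.exp (t * f ω * Complex.I) - Complex.exp (t * g ω * Complex.I) =
            Complex.exp (t * g ω * Complex.I) *
              (Complex.exp (Complex.I * (t * (f ω - g ω) : ℝ)) - 1) := by
          rw [mul_sub, ← Complex.exp_add, mul_one]
          congr 2
          push_cast
          ring
        rw [h1, norm_mul, hnorm, one_mul, hω, Pi.sub_apply]
        refine Real.norm_exp_I_mul_ofReal_sub_one_le.trans ?_
        rw [norm_mul, Real.norm_eq_abs t]
    _ = |t| * ∫ ω, ‖(f - g) ω‖ ∂P := integral_const_mul _ _
    _ ≤ _ := mul_le_mul_of_nonneg_left (integral_norm_le_Lp_norm (f - g)) (abs_nonneg t)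

lemma variance_Lp_two (f : Lp ℝ 2 P) : Var[f; P] = ‖f‖ ^ 2 - (∫ ω, f ω ∂P) ^ 2 := by
  rw [variance_eq_sub (Lp.memLp f), ← real_inner_self_eq_norm_sq, L2.inner_def]
  simp [sq]

/-- The centred Gaussian random variables form a closed subset of `L²`. -/
lemma isClosed_setOf_hasGaussianLaw :
    IsClosed {f : Lp ℝ 2 P | HasGaussianLaw f P ∧ ∫ ω, f ω ∂P = 0} := by
  -- A centred `f` has variance ‖f‖², so being Gaussian is a family of equations between functions
  -- continuous in `f`.
  have hset : {f : Lp ℝ 2 P | HasGaussianLaw f P ∧ ∫ ω, f ω ∂P = 0} =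
      (⋂ t : ℝ, {f : Lp ℝ 2 P | charFun (P.map f) t = Complex.exp (-(t ^ 2 * ‖f‖ ^ 2 : ℝ) / 2)}) ∩
        {f : Lp ℝ 2 P | ∫ ω, f ω ∂P = 0} := by
    ext f
    simp only [Set.mem_ofPred_eq, Set.mem_inter_iff, Set.mem_iInter]
    refine and_congr_left fun h0 => ?_
    rw [hasGaussianLaw_iff_charFun_map_eq (Lp.aestronglyMeasurable f).aemeasurable]
    refine forall_congr' fun t => ?_
    have h1 : ∫ ω, inner ℝ t (f ω) ∂P = 0 := by
      simp [integral_mul_const, h0]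
    have h2 : Var[fun ω => inner ℝ t (f ω); P] = t ^ 2 * ‖f‖ ^ 2 := by
      have := variance_const_mul t f P
      simp only [RCLike.inner_apply, conj_trivial]
      simp_rw [mul_comm _ t]
      rw [this, variance_Lp_two, h0]
      ring
    rw [h1, h2]
    simp [neg_div]
  rw [hset]
  refine IsClosed.inter (isClosed_iInter fun t => ?_)
    (isClosed_eq continuous_Lp_two_integral continuous_const)
  exact isClosed_eq (continuous_Lp_two_charFun t) (by fun_prop)

end L2

/-- The product of standard Gaussian measures. -/
noncomputable def stdGaussianPi (ι : Type*) : Measure (ι → ℝ) :=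
  Measure.infinitePi fun _ => gaussianReal 0 1

instance (ι : Type*) : IsProbabilityMeasure (stdGaussianPi ι) := by
  unfold stdGaussianPi
  infer_instance

lemma iIndepFun_stdGaussianPi (ι : Type*) :
    iIndepFun (fun (i : ι) (ω : ι → ℝ) => ω i) (stdGaussianPi ι) :=
  iIndepFun_infinitePi (X := fun _ => id) fun _ => measurable_id

lemma hasLaw_eval_stdGaussianPi {ι : Type*} (i : ι) :
    HasLaw (fun ω : ι → ℝ => ω i) (gaussianReal 0 1) (stdGaussianPi ι) :=
  ⟨(measurable_pi_apply i).aemeasurable, Measure.infinitePi_map_eval _ i⟩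

lemma isGaussianProcess_eval (ι : Type*) :
    IsGaussianProcess (fun (i : ι) (ω : ι → ℝ) => ω i) (stdGaussianPi ι) where
  hasGaussianLaw I :=
    iIndepFun.hasGaussianLaw (X := fun (i : I) (ω : ι → ℝ) => ω i)
      (fun i => (hasLaw_eval_stdGaussianPi i.1).hasGaussianLaw)
      ((iIndepFun_stdGaussianPi ι).precomp Subtype.val_injective)

lemma integral_eval_stdGaussianPi {ι : Type*} (i : ι) : ∫ ω, ω i ∂(stdGaussianPi ι) = 0 := by
  rw [(hasLaw_eval_stdGaussianPi i).integral_eq]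
  simp

/-- The coordinates of the Gaussian product space as elements of `L²`. -/
noncomputable def coordLp {ι : Type*} (i : ι) : Lp ℝ 2 (stdGaussianPi ι) :=
  (hasLaw_eval_stdGaussianPi i).hasGaussianLaw.memLp_two.toLp _

lemma coordLp_ae_eq {ι : Type*} (i : ι) : coordLp i =ᵐ[stdGaussianPi ι] fun ω => ω i :=
  MemLp.coeFn_toLp _

lemma orthonormal_coordLp (ι : Type*) : Orthonormal ℝ (coordLp (ι := ι)) := by
  classical
  rw [orthonormal_iff_ite]
  intro i j
  have hmem := fun i : ι => (hasLaw_eval_stdGaussianPi i).hasGaussianLaw.memLp_two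
  have h1 : inner ℝ (coordLp i) (coordLp j) = cov[fun ω => ω i, fun ω => ω j; stdGaussianPi ι] := by
    rw [covariance_eq_sub (hmem i) (hmem j), integral_eval_stdGaussianPi, zero_mul, sub_zero,
      L2.inner_def]
    refine integral_congr_ae ?_
    filter_upwards [coordLp_ae_eq i, coordLp_ae_eq j] with ω hi hj
    simp [hi, hj, mul_comm]
  rw [h1]
  split_ifs with hij
  · subst hij
    rw [covariance_self (measurable_pi_apply i).aemeasurable, (hasLaw_eval_stdGaussianPi i).variance_eq]
    simp
  · exact ((iIndepFun_stdGaussianPi ι).indepFun hij).covariance_eq_zero (hmem i) (hmem j)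

lemma sum_smul_coordLp_mem {ι : Type*} (s : Finset ι) (a : ι → ℝ) :
    ∑ i ∈ s, a i • coordLp i ∈
      {f : Lp ℝ 2 (stdGaussianPi ι) | HasGaussianLaw f (stdGaussianPi ι) ∧
        ∫ ω, f ω ∂(stdGaussianPi ι) = 0} := by
  have hae : (∑ i ∈ s, a i • coordLp i : Lp ℝ 2 (stdGaussianPi ι)) =ᵐ[stdGaussianPi ι]
      fun ω => ∑ i ∈ s, a i * ω i := by
    have h1 : ∀ᵐ ω ∂(stdGaussianPi ι), ∀ i ∈ s, (a i • coordLp i : Lp ℝ 2 (stdGaussianPi ι)) ω =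
        a i * ω i := by
      rw [Finset.eventually_all]
      intro i _
      filter_upwards [Lp.coeFn_smul (a i) (coordLp i), coordLp_ae_eq i] with ω h h'
      simp [h, h']
    filter_upwards [h1, Lp.coeFn_finsetSum s fun i => a i • coordLp i] with ω h h'
    rw [h', Finset.sum_apply]
    exact Finset.sum_congr rfl h
  refine ⟨?_, ?_⟩
  · exact (((isGaussianProcess_eval ι).smul a).hasGaussianLaw_fun_sum (I := s)).congr hae.symm
  · rw [integral_congr_ae hae, integral_finsetSum]
    · simp [integral_const_mul, integral_eval_stdGaussianPi]
    · exact fun i _ => (hasLaw_eval_stdGaussianPi i).hasGaussianLaw.integrable.const_mul _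

/-- The isonormal Gaussian process of a Hilbert space. -/
lemma exists_isonormal (V : Type) [NormedAddCommGroup V] [InnerProductSpace ℝ V]
    [CompleteSpace V] :
    ∃ (Ω : Type) (_ : MeasurableSpace Ω) (P : Measure Ω) (_ : IsProbabilityMeasure P)
      (W : V →ₗᵢ[ℝ] Lp ℝ 2 P), ∀ v, HasGaussianLaw (W v) P ∧ ∫ ω, W v ω ∂P = 0 := by
  obtain ⟨w, b, -⟩ := exists_hilbertBasis ℝ V
  let hF := (orthonormal_coordLp w).orthogonalFamily
  refine ⟨w → ℝ, inferInstance, stdGaussianPi w, inferInstance,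
    hF.linearIsometry.comp b.repr.toLinearIsometry, fun v => ?_⟩
  -- The image of `v` is an L² limit of finite combinations of independent Gaussian coordinates.
  refine isClosed_setOf_hasGaussianLaw.mem_of_tendsto (hF.hasSum_linearIsometry (b.repr v))
    (Filter.Eventually.of_forall fun s => ?_)
  exact sum_smul_coordLp_mem s fun i => b.repr v i

/-- Every positive definite kernel is the covariance function of a centred Gaussian process. -/
theorem IsPosDefKernel.exists_gaussianProcess {T : Type} {K : T → T → ℝ} (hK : IsPosDefKernel K) :
    ∃ (Ω : Type) (_ : MeasurableSpace Ω) (P : Measure Ω) (_ : IsProbabilityMeasure P)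
      (X : T → Ω → ℝ), (∀ t, Measurable (X t)) ∧ IsGaussianProcess X P ∧
        (∀ t, ∫ ω, X t ω ∂P = 0) ∧ ∀ s t, cov[X s, X t; P] = K s t := by
  classical
  obtain ⟨V, _, _, _, φ, hφ⟩ := hK.exists_inner_eq
  obtain ⟨Ω, _, P, _, W, hW⟩ := exists_isonormal V
  have hm : ∀ t, Measurable (W (φ t)) := fun t => (Lp.stronglyMeasurable _).measurable
  refine ⟨Ω, inferInstance, P, inferInstance, fun t => W (φ t), hm, ⟨fun I => ⟨?_⟩⟩,
    fun t => (hW _).2, fun s t => ?_⟩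
  -- By linearity of `W`, each linear functional of a finite subfamily is almost surely `W` of a
  -- single vector, hence Gaussian.
  · refine isGaussian_of_isGaussian_map fun L => ?_
    have hmI : Measurable fun ω => I.restrict fun t => W (φ t) ω :=
      measurable_pi_iff.2 fun i => hm i
    rw [Measure.map_map (by fun_prop) hmI]
    have hae : (L ∘ fun ω => I.restrict fun t => W (φ t) ω) =ᵐ[P]
        W (∑ i : I, L (Pi.single i 1) • φ i) := by
      have h1 : ∀ᵐ ω ∂P, ∀ i : I, (L (Pi.single i 1) • W (φ i) : Lp ℝ 2 P) ω =
          L (Pi.single i 1) * W (φ i) ω := by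
        rw [ae_all_iff]
        intro i
        filter_upwards [Lp.coeFn_smul (L (Pi.single i 1)) (W (φ i))] with ω h
        simp [h]
      rw [map_sum]
      simp_rw [map_smul]
      filter_upwards [h1, Lp.coeFn_finsetSum Finset.univ
        fun i : I => L (Pi.single i 1) • W (φ i)] with ω h h'
      rw [h', Finset.sum_apply, Finset.sum_congr rfl fun i _ => h i, Function.comp_apply,
        ← ContinuousLinearMap.coe_coe, LinearMap.pi_apply_eq_sum_univ]
      refine Finset.sum_congr rfl fun i _ => ?_
      rw [smul_eq_mul, mul_comm]
      congr 2
      ext j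
      simp [Pi.single_apply, eq_comm]
    rw [Measure.map_congr hae]
    exact (hW _).1.isGaussian_map
  · rw [covariance_eq_sub (Lp.memLp _) (Lp.memLp _), (hW _).2, zero_mul, sub_zero, ← hφ s t,
      ← W.inner_map_map, L2.inner_def]
    simp [mul_comm]

/-! ### The fractional Brownian kernel on the Wasserstein space. -/

lemma wassersteinDist_comm (μ ν : WassersteinSpace) :
    wassersteinDist μ ν = wassersteinDist ν μ := by
  rw [wassersteinDist_eq, wassersteinDist_eq, norm_sub_rev]

lemma sum_sum_fbmKernel (H : ℝ) (μ₀ : WassersteinSpace) {n : ℕ} (x : Fin n → WassersteinSpace)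
    (c : Fin n → ℝ) :
    ∑ i, ∑ j, c i * c j * fbmKernel H μ₀ (x i) (x j) = (1 / 2 : ℝ) * ∑ i, ∑ j, c i * c j *
      (‖quantileLp μ₀ - quantileLp (x i)‖ ^ (2 * H) + ‖quantileLp μ₀ - quantileLp (x j)‖ ^ (2 * H) -
        ‖quantileLp (x i) - quantileLp (x j)‖ ^ (2 * H)) := by
  simp_rw [Finset.mul_sum, fbmKernel, wassersteinDist_eq]
  exact Finset.sum_congr rfl fun i _ => Finset.sum_congr rfl fun j _ => by ring

lemma fbmKernel_zero (μ₀ μ ν : WassersteinSpace) : fbmKernel 0 μ₀ μ ν = 1 / 2 := by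
  simp [fbmKernel]

theorem isPosDefKernel_fbmKernel {H : ℝ} (h0 : 0 ≤ H) (h1 : H ≤ 1) (μ₀ : WassersteinSpace) :
    IsPosDefKernel (fbmKernel H μ₀) := by
  refine ⟨fun μ ν => ?_, fun n x c => ?_⟩
  · rw [fbmKernel, fbmKernel, wassersteinDist_comm μ ν, add_comm (wassersteinDist μ₀ μ ^ _)]
  rcases h0.eq_or_lt with rfl | h0
  · simp_rw [fbmKernel_zero, ← Finset.sum_mul, ← Finset.sum_mul_sum]
    exact mul_nonneg (mul_self_nonneg _) (by norm_num)
  rw [sum_sum_fbmKernel]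
  refine mul_nonneg (by norm_num) ?_
  rcases h1.eq_or_lt with rfl | h1
  · have h := sum_sum_norm_sq_eq (quantileLp μ₀) (fun i => quantileLp (x i)) c
    simp only [← Real.rpow_natCast, Nat.cast_ofNat] at h
    rw [mul_one, h]
    positivity
  · exact sum_sum_norm_rpow_nonneg h0 h1 (quantileLp μ₀) (fun i => quantileLp (x i)) c

lemma fbmKernel_translated (H : ℝ) (μ₀ : WassersteinSpace) (a b : ℝ) :
    fbmKernel H μ₀ (translated μ₀ a) (translated μ₀ b) =
      (1 / 2 : ℝ) * (|a| ^ (2 * H) + |b| ^ (2 * H) - |a - b| ^ (2 * H)) := by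
  have h : ∀ a, wassersteinDist μ₀ (translated μ₀ a) = |a| := fun a => by
    simpa [translated_zero] using wassersteinDist_translated μ₀ 0 a
  rw [fbmKernel, h, h, wassersteinDist_translated]

lemma translated_injective (μ : WassersteinSpace) : Function.Injective (translated μ) := by
  intro a b h
  have h' := wassersteinDist_translated μ a b
  rw [h, wassersteinDist_translated, sub_self, abs_zero] at h'
  exact sub_eq_zero.1 (abs_eq_zero.1 h'.symm)

lemma translated_ne (μ : WassersteinSpace) {a : ℝ} (ha : a ≠ 0) : translated μ a ≠ μ := fun h =>
  ha (translated_injective μ (h.trans (translated_zero μ).symm))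

theorem isNondegenerateKernel_fbmKernel_iff {H : ℝ} (h0 : 0 ≤ H) (h1 : H ≤ 1)
    (μ₀ : WassersteinSpace) :
    IsNondegenerateKernel (fun μ ν : {μ : WassersteinSpace // μ ≠ μ₀} => fbmKernel H μ₀ μ ν) ↔
      0 < H ∧ H < 1 := by
  constructor
  · rintro ⟨-, hpos⟩
    let x : Fin 2 → {μ : WassersteinSpace // μ ≠ μ₀} :=
      ![⟨translated μ₀ 1, translated_ne μ₀ one_ne_zero⟩,
        ⟨translated μ₀ 2, translated_ne μ₀ two_ne_zero⟩]
    have hx : Function.Injective x := by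
      have h12 : translated μ₀ 1 ≠ translated μ₀ 2 := (translated_injective μ₀).ne (by norm_num)
      intro i j hij
      fin_cases i <;> fin_cases j <;> simp_all [x, eq_comm]
    refine ⟨h0.lt_of_ne fun h => ?_, h1.lt_of_ne fun h => ?_⟩
    · subst h
      -- The kernel is constant, so weights with zero sum annihilate it.
      have h := hpos 2 x ![1, -1] hx (by simp)
      simp [Fin.sum_univ_two, fbmKernel_zero] at h
    · subst h
      -- On translates by a and b the kernel is ab, and 2·1 - 1·2 = 0.
      have h := hpos 2 x ![2, -1] hx (by simp)
      simp only [Fin.sum_univ_two, x, Matrix.cons_val_zero, Matrix.cons_val_one,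
        fbmKernel_translated] at h
      norm_num at h
  · rintro ⟨h0, h1⟩
    have hp := isPosDefKernel_fbmKernel h0.le h1.le μ₀
    refine ⟨⟨fun μ ν => hp.1 _ _, fun n x c => hp.2 n (fun i => (x i).1) c⟩, fun n x c hx hc => ?_⟩
    rw [sum_sum_fbmKernel H μ₀ (fun i => (x i).1) c]
    refine mul_pos (by norm_num) (sum_sum_norm_rpow_pos h0 h1 (quantileLp μ₀)
      (fun i => quantileLp (x i).1) c ?_ (fun i => quantileLp_injective.ne (x i).2) hc)
    exact quantileLp_injective.comp (Subtype.val_injective.comp hx)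

theorem mainTheorem2 (H : ℝ) (hH0 : 0 ≤ H) (hH1 : H ≤ 1) (μ₀ : WassersteinSpace) :
    IsPosDefKernel (fbmKernel H μ₀) ∧
    (∃ (Ω : Type) (_ : MeasurableSpace Ω) (P : Measure Ω) (_ : IsProbabilityMeasure P)
      (X : WassersteinSpace → Ω → ℝ), IsFractionalBrownianMotion P H μ₀ X) ∧
    (IsNondegenerateKernel
        (fun μ ν : {μ : WassersteinSpace // μ ≠ μ₀} => fbmKernel H μ₀ μ ν) ↔
      0 < H ∧ H < 1) := by
  have hp := isPosDefKernel_fbmKernel hH0 hH1 μ₀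
  refine ⟨hp, ?_, isNondegenerateKernel_fbmKernel_iff hH0 hH1 μ₀⟩
  obtain ⟨Ω, _, P, _, X, hm, hg, hc, hcov⟩ := hp.exists_gaussianProcess
  exact ⟨Ω, inferInstance, P, inferInstance, X, hm, hg, hc, hcov⟩
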